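/- Let $L$ be a set of labels. A labelled Markov process (LMP) $(S,\Sigma,\{\tau_a : a\in L\})$ consists of a measurable space $(S,\Sigma)$ and, for each $a\in L$, a function $\tau_a\colon S\times\Sigma\to[0,1]$ such that $\tau_a(s,\cdot)$ is a measure for every $s\in S$ (so $\tau_a(s,S)\le 1$) and $\tau_a(\cdot,Q)$ is $\Sigma$-measurable for every $Q\in\Sigma$. A zigzag morphism from $(S,\Sigma,\{\tau_a\})$ to $(S',\Sigma',\{\tau'_a\})$ is a surjective measurable map $f\colon S\to S'$ such that $\tau_a(s,f^{-1}(Q))=\tau'_a(f(s),Q)$ for all $a\in L$, $s\in S$, $Q\in\Sigma'$. Consider the category whose objects are the LMP $(S,\Sigma,\{\tau_a : a\in L\})$ such that $S$ is a separable metric space, $\Sigma$ is its Borel $\sigma$-algebra and every $\tau_a(s,\cdot)$ is a Radon measure (i.e. inner regular with respect to compact sets), and whose morphisms are the zigzag morphisms. A semipullback of a cospan $h_1\colon \mathbf S_1\to \mathbf S_0$, $h_2\colon \mathbf S_2\to \mathbf S_0$ in this category is an object $\mathbf S_3$ with morphisms $k_j\colon \mathbf S_3\to \mathbf S_j$ ($j=1,2$)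 such that $h_1\circ k_1=h_2\circ k_2$. **Theorem.** In this category every cospan has a semipullback. Moreover, for every cospan $h_1\colon \mathbf S_1\to \mathbf S_0$, $h_2\colon \mathbf S_2\to \mathbf S_0$, with underlying state spaces $S_1$, $S_0$, $S_2$, the set pullback $$S_3=\{(x_1,x_2)\in S_1\times S_2 : h_1(x_1)=h_2(x_2)\}$$ is a measurable subset of $S_1\times S_2$ (with the product $\sigma$-algebra), and the cospan has a semipullback whose state space is $S_3$, with the metric and the $\sigma$-algebra inherited from $S_1\times S_2$, and whose morphisms $k_1,k_2$ are the restrictions to $S_3$ of the coordinate projections. -/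

import Mathlib

open CategoryTheory ProbabilityTheory MeasureTheory

universe u v

/-- A labelled Markov process with label set `L`: a measurable space together with a family,
indexed by `L`, of subprobability kernels from the space to itself. -/
structure LMP (L : Type v) where
  /-- the set of states -/
  carrier : Type u
  /-- the `σ`-algebra on the states -/
  [measurableSpace : MeasurableSpace carrier]
  /-- the transition kernels -/
  τ : L → Kernel carrier carrier
  τ_le_one : ∀ a s, τ a s Set.univ ≤ 1

namespace LMP

instance (L : Type v) : CoeSort (LMP.{u} L) (Type u) := ⟨LMP.carrier⟩

attribute [instance] LMP.measurableSpace

/-- A zigzag morphism: a surjective measurable map compatible with all transition kernels. -/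
@[ext]
structure Zigzag {L : Type v} (S T : LMP.{u} L) where
  /-- the underlying map -/
  toFun : S → T
  measurable : Measurable toFun
  surjective : Function.Surjective toFun
  τ_preimage : ∀ (a : L) (s : S) (Q : Set T), MeasurableSet Q →
    S.τ a s (toFun ⁻¹' Q) = T.τ a (toFun s) Q

namespace Zigzag

variable {L : Type v} {S T U : LMP.{u} L}

/-- The identity map is a zigzag morphism. -/
def id (S : LMP.{u} L) : Zigzag S S where
  toFun s := s
  measurable := measurable_id
  surjective := Function.surjective_id
  τ_preimage _ _ _ _ := rfl

/-- Zigzag morphisms compose. -/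
def comp (f : Zigzag S T) (g : Zigzag T U) : Zigzag S U where
  toFun s := g.toFun (f.toFun s)
  measurable := g.measurable.comp f.measurable
  surjective := g.surjective.comp f.surjective
  τ_preimage a s Q hQ :=
    (f.τ_preimage a s (g.toFun ⁻¹' Q) (g.measurable hQ)).trans
      (g.τ_preimage a (f.toFun s) Q hQ)

end Zigzag

end LMP

/-- A labelled Markov process whose state space is a separable metric space with its Borel
`σ`-algebra and whose (finite) transition measures are Radon, that is, inner regular with respect
to compact sets. -/
structure RadonLMP (L : Type v) extends LMP.{u} L where
  /-- the metric on the states -/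
  [metricSpace : MetricSpace carrier]
  [separableSpace : TopologicalSpace.SeparableSpace carrier]
  [borelSpace : BorelSpace carrier]
  radon : ∀ a s, (τ a s).InnerRegular

namespace RadonLMP

variable {L : Type v}

instance : CoeSort (RadonLMP.{u} L) (Type u) := ⟨fun S => S.carrier⟩

attribute [instance] RadonLMP.metricSpace RadonLMP.separableSpace RadonLMP.borelSpace

instance (S : RadonLMP.{u} L) : SecondCountableTopology S :=
  UniformSpace.secondCountable_of_separable S

/-- The category of Radon labelled Markov processes over separable metric spaces, with zigzag
morphisms. -/
instance : Category (RadonLMP.{u} L) where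
  Hom S T := LMP.Zigzag S.toLMP T.toLMP
  id S := LMP.Zigzag.id S.toLMP
  comp f g := LMP.Zigzag.comp f g

instance (S T : RadonLMP.{u} L) : CoeFun (S ⟶ T) (fun _ => S → T) :=
  ⟨fun f => LMP.Zigzag.toFun f⟩

/-- A cospan has a semipullback if it can be completed to a commutative square in the category. -/
def HasSemipullback {S₀ S₁ S₂ : RadonLMP.{u} L} (h₁ : S₁ ⟶ S₀) (h₂ : S₂ ⟶ S₀) : Prop :=
  ∃ (T : RadonLMP.{u} L) (k₁ : T ⟶ S₁) (k₂ : T ⟶ S₂), CommSq k₁ k₂ h₁ h₂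

/-- The set pullback of a cospan, as a subset of the product of the state spaces. -/
def setPullback {S₀ S₁ S₂ : RadonLMP.{u} L} (h₁ : S₁ ⟶ S₀) (h₂ : S₂ ⟶ S₀) :
    Set (S₁ × S₂) :=
  {p | h₁ p.1 = h₂ p.2}

/-- A family of Radon subprobability kernels on the set pullback (with the metric and the
`σ`-algebra that it inherits from the product) gives an object of the category. -/
def ofSetPullback {S₀ S₁ S₂ : RadonLMP.{u} L} (h₁ : S₁ ⟶ S₀) (h₂ : S₂ ⟶ S₀)
    (τ : L → Kernel (setPullback h₁ h₂) (setPullback h₁ h₂))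
    (τ_le_one : ∀ a p, τ a p Set.univ ≤ 1) (radon : ∀ a p, (τ a p).InnerRegular) :
    RadonLMP.{u} L where
  carrier := setPullback h₁ h₂
  τ := τ
  τ_le_one := τ_le_one
  radon := radon

end RadonLMP

open Set

/-! For a label `a` and a point `(x₁, x₂)` of the set pullback, the measures `S₁.τ a x₁` and `S₂.τ a
x₂` have the same image on `S₀`, so the natural coupling makes them conditionally independent over
`S₀`. Disintegration that is measurable in the parameter needs standard Borel fibres, which `S₁` and
`S₂` need not have. Each is therefore coded by an injection into Cantor space inducing its
σ-algebra, and the coupling is built on `S₀ × (ℕ → Bool) × (ℕ → Bool)` (`exists_map_eq_of_fst_eq`).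
The Radon property brings it back: compact sets have measurable images, so the coupling is
concentrated on the possibly nonmeasurable image of the set pullback
(`ae_map_mem_range_of_injective`) and lifts along the code (`exists_lift_of_ae_mem_range`). The lift
is Radon because its marginals are tight. -/

/-- A measurable space that is countably generated and separates points carries the trace of the
`σ`-algebra of the Cantor space. -/
theorem exists_injective_comap_eq_nat_bool (α : Type*) [m : MeasurableSpace α]
    [MeasurableSpace.CountablyGenerated α] [MeasurableSpace.SeparatesPoints α] :
    ∃ f : α → ℕ → Bool, Function.Injective f ∧ MeasurableSpace.comap f inferInstance = m := by
  obtain ⟨s, ⟨e⟩⟩ := MeasurableSpace.measurableEquiv_nat_bool_of_countablyGenerated α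
  refine ⟨fun x => (e x : ℕ → Bool), Subtype.val_injective.comp e.injective, ?_⟩
  have h := e.measurableEmbedding.comap_eq
  exact MeasurableSpace.comap_comp.symm.trans h

/-! ### Radon measures: injective images and tightness -/

/-- The image of a compact set in a metric space under a measurable injection into a countably
separated space is measurable. -/
theorem IsCompact.measurableSet_image_of_injective {α β : Type*} [MetricSpace α]
    [MeasurableSpace α] [BorelSpace α] [MeasurableSpace β] [MeasurableSpace.CountablySeparated β]
    {f : α → β} (hf : Measurable f) (hinj : Function.Injective f) {K : Set α} (hK : IsCompact K) :
    MeasurableSet (f '' K) := by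
  have : CompactSpace K := isCompact_iff_compactSpace.mp hK
  -- Lusin–Souslin: a compact metric space is standard Borel.
  have h : MeasurableEmbedding (fun x : K => f x) :=
    (hf.comp measurable_subtype_coe).measurableEmbedding (hinj.comp Subtype.val_injective)
  rw [image_eq_range]
  exact h.measurableSet_range

theorem MeasureTheory.Measure.exists_isCompact_measure_compl_lt {α : Type*} [TopologicalSpace α]
    [T2Space α] [MeasurableSpace α] [BorelSpace α] (μ : Measure α) [IsFiniteMeasure μ]
    [μ.InnerRegular] {ε : ENNReal} (hε : 0 < ε) : ∃ K, IsCompact K ∧ μ Kᶜ < ε := by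
  obtain ⟨K, -, hK, h⟩ := MeasurableSet.univ.exists_isCompact_sdiff_lt
    (measure_ne_top μ univ) hε.ne'
  exact ⟨K, hK, by rwa [compl_eq_univ_sdiff]⟩

/-- A finite Radon measure is carried to a measure concentrated on the range by any measurable
injection into a countably separated space, even if this range is not measurable. -/
theorem MeasureTheory.Measure.ae_map_mem_range_of_injective {α β : Type*} [MetricSpace α]
    [MeasurableSpace α] [BorelSpace α] [MeasurableSpace β] [MeasurableSpace.CountablySeparated β]
    (μ : Measure α) [IsFiniteMeasure μ] [μ.InnerRegular]
    {f : α → β} (hf : Measurable f) (hinj : Function.Injective f) :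
    ∀ᵐ y ∂(μ.map f), y ∈ range f := by
  refine nonpos_iff_eq_zero.mp (le_of_forall_pos_le_add fun ε hε => ?_)
  obtain ⟨K, hK, hKε⟩ := μ.exists_isCompact_measure_compl_lt hε
  have hm := hK.measurableSet_image_of_injective hf hinj
  calc μ.map f (range f)ᶜ ≤ μ.map f (f '' K)ᶜ :=
        measure_mono (compl_subset_compl.mpr (image_subset_range f K))
    _ = μ Kᶜ := by rw [Measure.map_apply hf hm.compl, preimage_compl, hinj.preimage_image]
    _ ≤ 0 + ε := by rw [zero_add]; exact hKε.le

/-- A finite measure on a second countable metric space is Radon if it is tight. -/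
theorem MeasureTheory.Measure.innerRegular_of_forall_exists_isCompact {α : Type*} [MetricSpace α]
    [MeasurableSpace α] [BorelSpace α] (μ : Measure α) [IsFiniteMeasure μ]
    (h : ∀ ε, 0 < ε → ∃ K, IsCompact K ∧ μ Kᶜ < ε) : μ.InnerRegular := by
  -- Tightness lets a closed set be cut down to a compact one; closed inner regularity is automatic
  -- for a finite measure on a metric space.
  have h₁ : μ.InnerRegularWRT IsCompact IsClosed :=
    innerRegularWRT_of_exists_compl_lt (fun _ _ hA hB => hA.inter_right hB) h
  have h₂ : μ.InnerRegularWRT IsClosed MeasurableSet := fun A (hA : MeasurableSet A) r hr => by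
    obtain ⟨K, hKA, hK, hr⟩ := hA.exists_lt_isClosed_of_ne_top (measure_ne_top μ A) hr
    exact ⟨K, hKA, hK, hr⟩
  exact ⟨h₁.trans h₂⟩

/-- The pullback of a finite Radon measure to a measurable subspace is Radon. -/
theorem MeasureTheory.Measure.innerRegular_of_map_subtype_val {α : Type*} [MetricSpace α]
    [MeasurableSpace α] [BorelSpace α] {s : Set α} (hs : MeasurableSet s) (μ : Measure s)
    (h : (μ.map Subtype.val).InnerRegular) : μ.InnerRegular := by
  refine ⟨fun A hA r hr => ?_⟩
  have he := MeasurableEmbedding.subtype_coe hs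
  rw [← Subtype.val_injective.preimage_image A, ← he.map_apply] at hr
  obtain ⟨K, hKA, hK, hrK⟩ := h.innerRegular (he.measurableSet_image.mpr hA) r hr
  refine ⟨Subtype.val ⁻¹' K, ?_, ?_, by rwa [← he.map_apply]⟩
  · rw [← Subtype.val_injective.preimage_image A]
    exact preimage_mono hKA
  · refine Topology.IsInducing.subtypeVal.isCompact_preimage_iff ?_ |>.mpr hK
    exact hKA.trans (image_subset_range _ _)

/-- A measure on a product is tight if both its marginals are. -/
theorem MeasureTheory.Measure.exists_isCompact_measure_compl_lt_prod {α β : Type*}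
    [TopologicalSpace α] [T2Space α] [MeasurableSpace α] [BorelSpace α]
    [TopologicalSpace β] [T2Space β] [MeasurableSpace β] [BorelSpace β]
    (μ : Measure (α × β)) [IsFiniteMeasure μ]
    (h₁ : μ.fst.InnerRegular) (h₂ : μ.snd.InnerRegular) {ε : ENNReal} (hε : 0 < ε) :
    ∃ K, IsCompact K ∧ μ Kᶜ < ε := by
  obtain ⟨K₁, hK₁, hε₁⟩ := μ.fst.exists_isCompact_measure_compl_lt (ENNReal.half_pos hε.ne')
  obtain ⟨K₂, hK₂, hε₂⟩ := μ.snd.exists_isCompact_measure_compl_lt (ENNReal.half_pos hε.ne')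
  refine ⟨K₁ ×ˢ K₂, hK₁.prod hK₂, ?_⟩
  rw [Measure.fst_apply hK₁.measurableSet.compl] at hε₁
  rw [Measure.snd_apply hK₂.measurableSet.compl] at hε₂
  have hsub : (K₁ ×ˢ K₂)ᶜ ⊆ (Prod.fst ⁻¹' K₁ᶜ ∪ Prod.snd ⁻¹' K₂ᶜ : Set (α × β)) := by
    rintro ⟨x, y⟩ h
    by_cases hx : x ∈ K₁
    · exact Or.inr fun hy => h ⟨hx, hy⟩
    · exact Or.inl hx
  calc μ (K₁ ×ˢ K₂)ᶜ ≤ μ (Prod.fst ⁻¹' K₁ᶜ) + μ (Prod.snd ⁻¹' K₂ᶜ) :=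
        (measure_mono hsub).trans (measure_union_le _ _)
    _ < ε / 2 + ε / 2 := ENNReal.add_lt_add hε₁ hε₂
    _ = ε := ENNReal.add_halves ε

theorem exists_measurableSet_preimage_eq_of_comap_eq {α β : Type*} {mα : MeasurableSpace α}
    {mβ : MeasurableSpace β} {i : α → β} (h : mβ.comap i = mα) {s : Set α} (hs : MeasurableSet s) :
    ∃ t, MeasurableSet t ∧ i ⁻¹' t = s := by
  subst h
  exact hs

instance Prod.separatesPoints {α β : Type*} [MeasurableSpace α] [MeasurableSpace β]
    [MeasurableSpace.SeparatesPoints α] [MeasurableSpace.SeparatesPoints β] :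
    MeasurableSpace.SeparatesPoints (α × β) :=
  ⟨fun _ _ h => Prod.ext
    (MeasurableSpace.SeparatesPoints.separates _ _ fun _ hs => h _ (measurable_fst hs))
    (MeasurableSpace.SeparatesPoints.separates _ _ fun _ hs => h _ (measurable_snd hs))⟩

/-! ### Lifting and coupling kernels -/

namespace ProbabilityTheory.Kernel

variable {Ω α β γ : Type*} [MeasurableSpace Ω] [MeasurableSpace α]
  [MeasurableSpace β] [MeasurableSpace γ]

/-- A kernel whose measures are concentrated on the (possibly not measurable) range of an injection
inducing the `σ`-algebra of its domain lifts along this injection. -/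
theorem exists_lift_of_ae_mem_range {i : α → β} (hi : Function.Injective i)
    (hcomap : MeasurableSpace.comap i inferInstance = (inferInstance : MeasurableSpace α))
    (η : Kernel Ω β) (hη : ∀ ω, ∀ᵐ y ∂(η ω), y ∈ range i) :
    ∃ κ : Kernel Ω α, κ.map i = η := by
  have him : Measurable i := measurable_iff_comap_le.mpr hcomap.le
  have hrange : ∀ ω, NullMeasurableSet (range i) (η ω) := fun ω =>
    NullMeasurableSet.compl_iff.mp (NullMeasurableSet.of_null (hη ω))
  -- `Measure.comap` is zero by default unless measurable sets have null measurable images.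
  have hnull : ∀ ω s, MeasurableSet s → NullMeasurableSet (i '' s) (η ω) := fun ω s hs => by
    obtain ⟨t, ht, rfl⟩ := exists_measurableSet_preimage_eq_of_comap_eq hcomap hs
    rw [image_preimage_eq_inter_range]
    exact ht.nullMeasurableSet.inter (hrange ω)
  have happly : ∀ ω t, MeasurableSet t → (η ω).comap i (i ⁻¹' t) = η ω t := fun ω t ht => by
    rw [Measure.comap_apply₀ i _ hi (hnull ω) (him ht).nullMeasurableSet,
      image_preimage_eq_inter_range]
    exact measure_congr (inter_ae_eq_left_of_ae_eq_univ (Filter.eventuallyEq_univ.mpr (hη ω)))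
  refine ⟨⟨fun ω => (η ω).comap i, Measure.measurable_of_measurable_coe _ fun s hs => ?_⟩, ?_⟩
  · obtain ⟨t, ht, rfl⟩ := exists_measurableSet_preimage_eq_of_comap_eq hcomap hs
    simp_rw [happly _ t ht]
    exact η.measurable_coe ht
  · ext ω t ht
    rw [Kernel.map_apply' _ him _ ht]
    exact happly ω t ht

/-- Two kernels with the same marginal on a common factor have a conditionally independent joint
extension, which depends measurably on the parameter. -/
theorem exists_map_eq_of_fst_eq [MeasurableSpace.CountableOrCountablyGenerated Ω β]
    [StandardBorelSpace α] [Nonempty α] [StandardBorelSpace γ] [Nonempty γ]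
    (ρ₁ : Kernel Ω (β × α)) (ρ₂ : Kernel Ω (β × γ)) [IsFiniteKernel ρ₁] [IsFiniteKernel ρ₂]
    (h : ρ₁.fst = ρ₂.fst) :
    ∃ η : Kernel Ω (β × α × γ),
      η.map (fun p => (p.1, p.2.1)) = ρ₁ ∧ η.map (fun p => (p.1, p.2.2)) = ρ₂ := by
  -- Draw the common factor, then the other two coordinates independently given it.
  refine ⟨ρ₁.fst ⊗ₖ (ρ₁.condKernel ×ₖ ρ₂.condKernel), ?_, ?_⟩
  · conv_rhs => rw [← ρ₁.disintegrate ρ₁.condKernel]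
    ext ω s hs
    rw [map_apply' _ (by fun_prop) _ hs, compProd_apply (hs.preimage (by fun_prop)),
      compProd_apply hs]
    refine lintegral_congr fun b => ?_
    conv_rhs => rw [← fst_prod ρ₁.condKernel ρ₂.condKernel]
    rw [fst_apply' _ _ (measurable_prodMk_left hs)]
    rfl
  · conv_rhs => rw [← ρ₂.disintegrate ρ₂.condKernel, ← h]
    ext ω s hs
    rw [map_apply' _ (by fun_prop) _ hs, compProd_apply (hs.preimage (by fun_prop)),
      compProd_apply hs]
    refine lintegral_congr fun b => ?_
    conv_rhs => rw [← snd_prod ρ₁.condKernel ρ₂.condKernel]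
    rw [snd_apply' _ _ (measurable_prodMk_left hs)]
    rfl

/-- A kernel is determined by its image under a map inducing the `σ`-algebra. -/
theorem eq_of_map_eq_of_comap_eq {i : α → β}
    (hcomap : MeasurableSpace.comap i inferInstance = (inferInstance : MeasurableSpace α))
    {κ κ' : Kernel Ω α} (h : κ.map i = κ'.map i) : κ = κ' := by
  have him : Measurable i := measurable_iff_comap_le.mpr hcomap.le
  ext ω s hs
  obtain ⟨t, ht, rfl⟩ := exists_measurableSet_preimage_eq_of_comap_eq hcomap hs
  rw [← map_apply' _ him _ ht, ← map_apply' _ him _ ht, h]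

end ProbabilityTheory.Kernel

/-- Taking comaps commutes with suprema and composition. This makes the pair of Cantor codes induce
the σ-algebra of the set pullback. -/
theorem comap_prodMap_subtype_val_eq {α β γ δ : Type*} [mα : MeasurableSpace α]
    [mβ : MeasurableSpace β] [mγ : MeasurableSpace γ] [mδ : MeasurableSpace δ]
    {f : α → γ} {g : β → δ} (hf : mγ.comap f = mα) (hg : mδ.comap g = mβ) (s : Set (α × β)) :
    MeasurableSpace.comap (fun p : s => (f p.1.1, g p.1.2)) inferInstance
      = (inferInstance : MeasurableSpace s) := by
  subst hf hg
  simp only [Subtype.instMeasurableSpace, Prod.instMeasurableSpace, MeasurableSpace.prod,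
    MeasurableSpace.comap_sup, MeasurableSpace.comap_comp]
  rfl

/-! ### Coupling on the set pullback -/

/-- Finite Radon kernels with a common image in a countably generated space have a joint extension
by Radon measures on the set pullback. -/
theorem ProbabilityTheory.Kernel.exists_innerRegular_pullback {Ω X₀ X₁ X₂ : Type*}
    [MeasurableSpace Ω]
    [MeasurableSpace X₀] [MeasurableSpace.CountablyGenerated X₀] [MeasurableSpace.SeparatesPoints X₀]
    [MetricSpace X₁] [SecondCountableTopology X₁] [MeasurableSpace X₁] [BorelSpace X₁]
    [MetricSpace X₂] [SecondCountableTopology X₂] [MeasurableSpace X₂] [BorelSpace X₂]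
    {h₁ : X₁ → X₀} {h₂ : X₂ → X₀} (hm₁ : Measurable h₁) (hm₂ : Measurable h₂)
    (hs : MeasurableSet {p : X₁ × X₂ | h₁ p.1 = h₂ p.2})
    (κ₁ : Kernel Ω X₁) (κ₂ : Kernel Ω X₂) [IsFiniteKernel κ₁] [IsFiniteKernel κ₂]
    (hr₁ : ∀ ω, (κ₁ ω).InnerRegular) (hr₂ : ∀ ω, (κ₂ ω).InnerRegular)
    (h : κ₁.map h₁ = κ₂.map h₂) :
    ∃ κ : Kernel Ω {p : X₁ × X₂ | h₁ p.1 = h₂ p.2},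
      κ.map (fun p => p.1.1) = κ₁ ∧ κ.map (fun p => p.1.2) = κ₂ ∧ ∀ ω, (κ ω).InnerRegular := by
  obtain ⟨ι₁, hi₁, hc₁⟩ := exists_injective_comap_eq_nat_bool X₁
  obtain ⟨ι₂, hi₂, hc₂⟩ := exists_injective_comap_eq_nat_bool X₂
  have hι₁ : Measurable ι₁ := measurable_iff_comap_le.mpr hc₁.le
  have hι₂ : Measurable ι₂ := measurable_iff_comap_le.mpr hc₂.le
  have hj₁ : Measurable fun x => (h₁ x, ι₁ x) := hm₁.prodMk hι₁
  have hj₂ : Measurable fun x => (h₂ x, ι₂ x) := hm₂.prodMk hι₂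
  have hfst : (κ₁.map fun x => (h₁ x, ι₁ x)).fst = (κ₂.map fun x => (h₂ x, ι₂ x)).fst := by
    rw [fst_map_prod _ hι₁, fst_map_prod _ hι₂, h]
  obtain ⟨η, hη₁, hη₂⟩ := exists_map_eq_of_fst_eq _ _ hfst
  let j : {p : X₁ × X₂ | h₁ p.1 = h₂ p.2} → X₀ × (ℕ → Bool) × (ℕ → Bool) :=
    fun p => (h₁ p.1.1, ι₁ p.1.1, ι₂ p.1.2)
  have hj : Function.Injective j := fun p q hpq =>
    Subtype.ext (Prod.ext (hi₁ (congrArg (·.2.1) hpq)) (hi₂ (congrArg (·.2.2) hpq)))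
  have : MeasurableSpace.CountablySeparated (X₀ × (ℕ → Bool)) :=
    MeasurableSpace.countablySeparated_of_separatesPoints
  have hc : MeasurableSpace.comap j inferInstance =
      (inferInstance : MeasurableSpace {p : X₁ × X₂ | h₁ p.1 = h₂ p.2}) := by
    refine (MeasurableSpace.comap_prodMk _ _).trans ?_
    -- The two codes already induce everything; the `X₀` coordinate adds no new sets.
    rw [comap_prodMap_subtype_val_eq hc₁ hc₂, sup_eq_right]
    exact (hm₁.comp (measurable_fst.comp measurable_subtype_coe)).comap_le
  have hjm : Measurable j := measurable_iff_comap_le.mpr hc.le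
  have hae : ∀ ω, ∀ᵐ y ∂(η ω), y ∈ range j := fun ω => by
    have ae₁ := (κ₁ ω).ae_map_mem_range_of_injective hj₁
      fun x y hxy => hi₁ (congrArg Prod.snd hxy)
    have ae₂ := (κ₂ ω).ae_map_mem_range_of_injective hj₂
      fun x y hxy => hi₂ (congrArg Prod.snd hxy)
    rw [← Kernel.map_apply _ hj₁, ← hη₁, Kernel.map_apply _ (by fun_prop)] at ae₁
    rw [← Kernel.map_apply _ hj₂, ← hη₂, Kernel.map_apply _ (by fun_prop)] at ae₂
    filter_upwards [ae_of_ae_map (by fun_prop) ae₁, ae_of_ae_map (by fun_prop) ae₂]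
    -- Both decoded points lie over the same `y`, which puts the pair in the set pullback.
    rintro ⟨y, z₁, z₂⟩ ⟨x₁, hx₁⟩ ⟨x₂, hx₂⟩
    simp only [Prod.mk.injEq] at hx₁ hx₂
    exact ⟨⟨(x₁, x₂), hx₁.1.trans hx₂.1.symm⟩,
      Prod.ext hx₁.1 (Prod.ext hx₁.2 hx₂.2)⟩
  obtain ⟨κ, hκ⟩ := exists_lift_of_ae_mem_range hj hc η hae
  have hp₁ : Measurable fun p : {p : X₁ × X₂ | h₁ p.1 = h₂ p.2} => p.1.1 := by fun_prop
  have hp₂ : Measurable fun p : {p : X₁ × X₂ | h₁ p.1 = h₂ p.2} => p.1.2 := by fun_prop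
  have hκ₁ : κ.map (fun p => p.1.1) = κ₁ := by
    refine eq_of_map_eq_of_comap_eq hc₁ ?_
    rw [← snd_map_prod _ hm₁ (g := ι₁), ← snd_map_prod _ hm₁ (g := ι₁), ← hη₁, ← hκ,
      ← map_comp_right _ hjm (by fun_prop), ← map_comp_right _ hp₁ hj₁]
    rfl
  have hκ₂ : κ.map (fun p => p.1.2) = κ₂ := by
    refine eq_of_map_eq_of_comap_eq hc₂ ?_
    rw [← snd_map_prod _ hm₂ (g := ι₂), ← snd_map_prod _ hm₂ (g := ι₂), ← hη₂, ← hκ,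
      ← map_comp_right _ hjm (by fun_prop), ← map_comp_right _ hp₂ hj₂]
    congr 2
    funext p
    -- `j` records the common value through `h₁`, whereas this marginal needs it through `h₂`.
    exact Prod.ext p.2.symm rfl
  refine ⟨κ, hκ₁, hκ₂, fun ω => ?_⟩
  have hfin : IsFiniteMeasure (κ ω) := ⟨by
    rw [← preimage_univ (f := fun p : {p : X₁ × X₂ | h₁ p.1 = h₂ p.2} => p.1.1),
      ← Kernel.map_apply' _ hp₁ _ MeasurableSet.univ, hκ₁]
    exact measure_lt_top _ _⟩
  -- Measurability of the set pullback reduces the claim to the ambient product, where tightness is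
  -- read off the marginals.
  refine Measure.innerRegular_of_map_subtype_val hs _ ?_
  refine Measure.innerRegular_of_forall_exists_isCompact _ fun ε hε =>
    Measure.exists_isCompact_measure_compl_lt_prod _ ?_ ?_ hε
  · rw [Measure.fst, Measure.map_map measurable_fst measurable_subtype_coe]
    convert hr₁ ω
    rw [← hκ₁, Kernel.map_apply _ hp₁]
    rfl
  · rw [Measure.snd, Measure.map_map measurable_snd measurable_subtype_coe]
    convert hr₂ ω
    rw [← hκ₂, Kernel.map_apply _ hp₂]
    rfl

/-! ### Semipullbacks of Radon processes -/

namespace RadonLMP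

variable {L : Type v}

instance (S : RadonLMP.{u} L) (a : L) : IsFiniteKernel (S.τ a) :=
  ⟨1, ENNReal.one_lt_top, S.τ_le_one a⟩

/-- The second countable metric space `S₀` has a measurable diagonal. -/
theorem measurableSet_setPullback {S₀ S₁ S₂ : RadonLMP.{u} L} (h₁ : S₁ ⟶ S₀) (h₂ : S₂ ⟶ S₀) :
    MeasurableSet (setPullback h₁ h₂) :=
  measurableSet_eq_fun (LMP.Zigzag.measurable h₁ |>.comp measurable_fst)
    (LMP.Zigzag.measurable h₂ |>.comp measurable_snd)

/-- The set pullback of a cospan carries Radon transition kernels for which both coordinate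
projections preserve the transition kernels. -/
theorem exists_kernel_setPullback {S₀ S₁ S₂ : RadonLMP.{u} L} (h₁ : S₁ ⟶ S₀) (h₂ : S₂ ⟶ S₀)
    (a : L) :
    ∃ κ : Kernel (setPullback h₁ h₂) (setPullback h₁ h₂),
      (∀ p, (κ p).map (fun q => q.1.1) = S₁.τ a p.1.1) ∧
      (∀ p, (κ p).map (fun q => q.1.2) = S₂.τ a p.1.2) ∧ ∀ p, (κ p).InnerRegular := by
  have hp₁ : Measurable fun p : setPullback h₁ h₂ => p.1.1 := by fun_prop
  have hp₂ : Measurable fun p : setPullback h₁ h₂ => p.1.2 := by fun_prop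
  have hm₁ := LMP.Zigzag.measurable h₁
  have hm₂ := LMP.Zigzag.measurable h₂
  obtain ⟨κ, hκ₁, hκ₂, hr⟩ := Kernel.exists_innerRegular_pullback hm₁ hm₂
    (measurableSet_setPullback h₁ h₂) ((S₁.τ a).comap _ hp₁) ((S₂.τ a).comap _ hp₂)
    (fun p => S₁.radon a p.1.1) (fun p => S₂.radon a p.1.2) (by
      ext p Q hQ
      rw [Kernel.map_apply' _ hm₁ _ hQ, Kernel.map_apply' _ hm₂ _ hQ, Kernel.comap_apply,
        Kernel.comap_apply, LMP.Zigzag.τ_preimage h₁ a _ Q hQ, LMP.Zigzag.τ_preimage h₂ a _ Q hQ]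
      exact congrArg (fun x => S₀.τ a x Q) p.2)
  refine ⟨κ, fun p => ?_, fun p => ?_, hr⟩
  · exact (Kernel.map_apply _ hp₁ p).symm.trans (DFunLike.congr_fun hκ₁ p)
  · exact (Kernel.map_apply _ hp₂ p).symm.trans (DFunLike.congr_fun hκ₂ p)

end RadonLMP

theorem mainTheorem2 {L : Type v} {S₀ S₁ S₂ : RadonLMP.{u} L} (h₁ : S₁ ⟶ S₀) (h₂ : S₂ ⟶ S₀) :
    RadonLMP.HasSemipullback h₁ h₂ ∧
    MeasurableSet (RadonLMP.setPullback h₁ h₂) ∧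
    ∃ (τ₃ : L → Kernel (RadonLMP.setPullback h₁ h₂) (RadonLMP.setPullback h₁ h₂))
      (τ₃_le_one : ∀ a p, τ₃ a p Set.univ ≤ 1)
      (radon : ∀ a p, (τ₃ a p).InnerRegular)
      (k₁ : RadonLMP.ofSetPullback h₁ h₂ τ₃ τ₃_le_one radon ⟶ S₁)
      (k₂ : RadonLMP.ofSetPullback h₁ h₂ τ₃ τ₃_le_one radon ⟶ S₂),
      (∀ p : RadonLMP.setPullback h₁ h₂, k₁ p = p.1.1) ∧
      (∀ p : RadonLMP.setPullback h₁ h₂, k₂ p = p.1.2) ∧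
      CommSq k₁ k₂ h₁ h₂ := by
  have hp₁ : Measurable fun p : RadonLMP.setPullback h₁ h₂ => p.1.1 := by fun_prop
  have hp₂ : Measurable fun p : RadonLMP.setPullback h₁ h₂ => p.1.2 := by fun_prop
  choose τ₃ hτ₁ hτ₂ radon using RadonLMP.exists_kernel_setPullback h₁ h₂
  have τ₃_le_one : ∀ a p, τ₃ a p univ ≤ 1 := fun a p => by
    rw [← preimage_univ (f := fun q : RadonLMP.setPullback h₁ h₂ => q.1.1),
      ← Measure.map_apply hp₁ MeasurableSet.univ, hτ₁]
    exact S₁.τ_le_one a p.1.1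
  let T := RadonLMP.ofSetPullback h₁ h₂ τ₃ τ₃_le_one radon
  let k₁ : T ⟶ S₁ :=
    { toFun := fun p => p.1.1
      measurable := hp₁
      -- Surjectivity of each projection comes from that of the opposite leg of the cospan.
      surjective := fun x =>
        let ⟨y, hy⟩ := LMP.Zigzag.surjective h₂ (h₁ x)
        ⟨⟨(x, y), hy.symm⟩, rfl⟩
      τ_preimage := fun a p Q hQ => by
        rw [← hτ₁ a p, Measure.map_apply hp₁ hQ]
        rfl }
  let k₂ : T ⟶ S₂ :=
    { toFun := fun p => p.1.2
      measurable := hp₂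
      surjective := fun y =>
        let ⟨x, hx⟩ := LMP.Zigzag.surjective h₁ (h₂ y)
        ⟨⟨(x, y), hx⟩, rfl⟩
      τ_preimage := fun a p Q hQ => by
        rw [← hτ₂ a p, Measure.map_apply hp₂ hQ]
        rfl }
  have hsq : CommSq k₁ k₂ h₁ h₂ := ⟨LMP.Zigzag.ext (funext fun p => p.2)⟩
  exact ⟨⟨T, k₁, k₂, hsq⟩, RadonLMP.measurableSet_setPullback h₁ h₂,
    τ₃, τ₃_le_one, radon, k₁, k₂, fun _ => rfl, fun _ => rfl, hsq⟩
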